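/- Let $\mathbb{F}$ be an algebraically closed field, let $m,r\ge 0$ and $1\le p\le N-2$ be integers, and let there be given nodes $\sigma_0,\dots,\sigma_{N-1}\in\mathbb{F}$, nonzero poles $\xi_1,\dots,\xi_N\in\mathbb{F}\cup\{\infty\}$, nonzero scaling parameters $\beta_0,\dots,\beta_N\in\mathbb{F}$, and constant matrices $\widetilde D_0,\dots,\widetilde D_p\in\mathbb{F}^{m\times m}$, $\widetilde L_{p+1},\dots,\widetilde L_N\in\mathbb{F}^{m\times r}$ and $\widetilde U\in\mathbb{F}^{m\times r}$. Put $g_i=\beta_i(1-\lambda/\xi_i)$ (with $\lambda/\infty=0$), $h_j=\lambda-\sigma_j$, $b_i(\lambda)=\frac1{\beta_0}\prod_{k=1}^i\frac{h_{k-1}}{g_k}$ for $0\le i\le N$, and $$\widetilde Q_N(\lambda)=\sum_{i=0}^p b_i(\lambda)\widetilde D_i+\sum_{i=p+1}^N b_i(\lambda)\widetilde L_i\widetilde U^T\in\mathbb{F}(\lambda)^{m\times m}.$$ Let $\widetilde L_N(\lambda)=\begin{bmatrix}\widetilde M_N(\lambda)\\ \widetilde K_N(\lambda)\end{bmatrix}$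 be the pencil with $$\widetilde M_N=\Big[\tfrac{g_N}{\beta_N}\widetilde D_0\ \cdots\ \tfrac{g_N}{\beta_N}\widetilde D_p\ \ \tfrac{g_N}{\beta_N}\widetilde L_{p+1}\ \cdots\ \tfrac{g_N}{\beta_N}\widetilde L_{N-2}\ \ \tfrac{g_N}{\beta_N}\widetilde L_{N-1}+\tfrac{h_{N-1}}{\beta_N}\widetilde L_N\Big],$$ and let $\widetilde K_N$ be the block upper bidiagonal pencil with block rows $0,\dots,N-2$ and block columns $0,\dots,N-1$ whose block row $i$ has, in block columns $i$ and $i+1$, the blocks $-h_iI_m,\ g_{i+1}I_m$ if $i<p$; $-h_p\widetilde U^T,\ g_{p+1}I_r$ if $i=p$; and $-h_iI_r,\ g_{i+1}I_r$ if $i>p$; all its other blocks are zero. Let $\widetilde A_N$ be $\widetilde K_N$ without its first block column, and partition $$\widetilde L_N(\lambda)=\begin{bmatrix}\widetilde D_N(\lambda)&-\widetilde C_N(\lambda)\\ \widetilde B_N(\lambda)&\widetilde A_N(\lambda)\end{bmatrix},$$ where $\widetilde B_N$ is the first block column of $\widetilde K_N$, and $\widetilde D_N$ is the first block of $\widetilde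 M_N$. Let $$\widetilde R_N=\begin{bmatrix}\widetilde R_N^{(1)}&\widetilde R_N^{(2)}\\ \big(\prod_{i=1}^{p-1}\frac{g_i}{h_i}\big)g_p I_m&0\\ -h_p\widetilde U^T&\big(\prod_{i=p+1}^{N-2}\frac{g_i}{h_i}\big)g_{N-1}I_r\end{bmatrix}\in\mathbb{F}(\lambda)^{(2m+r)\times(m+r)},$$ $$\widetilde R_N^{(1)}=\frac{g_N}{h_{N-1}}\Big[\sum_{j=1}^{p-1}\Big(\prod_{k=j+1}^p\frac{g_k}{h_{k-1}}\Big)\widetilde D_j+\widetilde D_p\Big],\qquad \widetilde R_N^{(2)}=\sum_{j=p+1}^{N-1}\Big(\prod_{k=j+1}^N\frac{g_k}{h_{k-1}}\Big)\widetilde L_j+\widetilde L_N .$$ Assume that $\operatorname{rank}\widetilde U=r$, that $\xi_i\neq\sigma_j$ for $1\le i\le N$ and $0\le j\le N-1$, and that $\widetilde R_N(\xi_k)$ has full column rank $m+r$ for every finite $\xi_k$ among $\xi_1,\dots,\xi_{N-1}$. Then $\widetilde L_N(\lambda)$ is a linearization of $\widetilde Q_N(\lambda)$ with state matrix $\widetilde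 A_N(\lambda)$ in $\mathbb{F}$ if $\xi_N=\infty$, and in $\mathbb{F}\setminus\{\xi_N\}$ if $\xi_N$ is finite. Here a pencil (a polynomial matrix with entries of degree at most $1$), partitioned so that its blocks are $A$ (the state matrix, $n\times n$ with $\det A\not\equiv0$), $B$, $-C$ and $D$, with $D$ of size $q\times s$, is a linearization of $G\in\mathbb{F}(\lambda)^{a\times b}$ in a nonempty set $\Omega\subseteq\mathbb{F}$ if for every $\lambda_0\in\Omega$: (a) $\operatorname{rank}\begin{bmatrix}A(\lambda_0)\\ C(\lambda_0)\end{bmatrix}=\operatorname{rank}\begin{bmatrix}A(\lambda_0)&B(\lambda_0)\end{bmatrix}=n$; and (b) there are integers $s_1,s_2\ge0$ with $s_1-s_2=q-a=s-b$ and square rational matrices $R_1,R_2$ of sizes $a+s_1$ and $b+s_1$ that are regular at $\lambda_0$ (defined at $\lambda_0$, with $\det R_i(\lambda_0)\ne0$) such that $R_1\operatorname{diag}(G,I_{s_1})R_2=\operatorname{diag}(\widehat G,I_{s_2})$, where $\widehat G=D+CA^{-1}B$. -/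

import Mathlib

namespace NLEIGS

open Polynomial

/-! ### Rational and polynomial matrices at a point -/

/-- The value `G(z)` of a rational matrix (meaningful where `G` is defined). -/
noncomputable def evalRat {F ι κ : Type*} [Field F] (G : Matrix ι κ (RatFunc F)) (z : F) :
    Matrix ι κ F :=
  G.map (RatFunc.eval (RingHom.id F) z)

/-- The value `P(z)` of a polynomial matrix. -/
noncomputable def evalPoly {F ι κ : Type*} [Field F] (P : Matrix ι κ F[X]) (z : F) :
    Matrix ι κ F :=
  P.map (Polynomial.eval z)

/-- A polynomial matrix regarded as a rational matrix. -/
noncomputable def toRat {F ι κ : Type*} [Field F] (P : Matrix ι κ F[X]) :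
    Matrix ι κ (RatFunc F) :=
  P.map (algebraMap F[X] (RatFunc F))

/-- The rational matrix `G` is defined at `z`: no entry has a pole at `z`. -/
def DefinedAt {F ι κ : Type*} [Field F] (G : Matrix ι κ (RatFunc F)) (z : F) : Prop :=
  ∀ i j, (G i j).denom.eval z ≠ 0

/-- The square rational matrix `G` is regular (invertible) at `z`: it is defined at `z` and
`det G(z) ≠ 0`. -/
def RegularAt {F ι : Type*} [Field F] [Fintype ι] [DecidableEq ι]
    (G : Matrix ι ι (RatFunc F)) (z : F) : Prop :=
  DefinedAt G z ∧ (evalRat G z).det ≠ 0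

/-! ### Polynomial system matrices

A polynomial system matrix is a polynomial matrix `P` together with a partition of its rows and
columns. The partition is given by bijections `rows : n ⊕ q ≃ R` and `cols : n ⊕ s ≃ S`, where `n`
indexes the rows and columns of the state matrix. After the corresponding permutations, `P` is
`[A, B; -C, D]`. -/

section SystemMatrix

variable {F R S n q s : Type*} [Field F]

/-- The state matrix `A`. -/
def stateBlock (P : Matrix R S F[X]) (rows : n ⊕ q ≃ R) (cols : n ⊕ s ≃ S) : Matrix n n F[X] :=
  P.submatrix (fun i => rows (Sum.inl i)) (fun j => cols (Sum.inl j))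

/-- The block `B`. -/
def inputBlock (P : Matrix R S F[X]) (rows : n ⊕ q ≃ R) (cols : n ⊕ s ≃ S) : Matrix n s F[X] :=
  P.submatrix (fun i => rows (Sum.inl i)) (fun j => cols (Sum.inr j))

/-- The block `C` (the corresponding submatrix of `P` is `-C`). -/
noncomputable def outputBlock (P : Matrix R S F[X]) (rows : n ⊕ q ≃ R) (cols : n ⊕ s ≃ S) :
    Matrix q n F[X] :=
  -P.submatrix (fun i => rows (Sum.inr i)) (fun j => cols (Sum.inl j))

/-- The block `D`. -/
def directBlock (P : Matrix R S F[X]) (rows : n ⊕ q ≃ R) (cols : n ⊕ s ≃ S) : Matrix q s F[X] :=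
  P.submatrix (fun i => rows (Sum.inr i)) (fun j => cols (Sum.inr j))

variable [Fintype n] [DecidableEq n]

/-- The transfer function matrix `D + C A⁻¹ B`. -/
noncomputable def transferFunction (P : Matrix R S F[X]) (rows : n ⊕ q ≃ R) (cols : n ⊕ s ≃ S) :
    Matrix q s (RatFunc F) :=
  toRat (directBlock P rows cols) +
    toRat (outputBlock P rows cols) * (toRat (stateBlock P rows cols))⁻¹ *
      toRat (inputBlock P rows cols)

/-- Minimality at `z`: `rank [A(z); C(z)] = rank [A(z), B(z)] = n`. For an empty state matrix this
always holds. -/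
def MinimalAt [Fintype s] (P : Matrix R S F[X]) (rows : n ⊕ q ≃ R) (cols : n ⊕ s ≃ S)
    (z : F) : Prop :=
  (Matrix.fromRows (evalPoly (stateBlock P rows cols) z)
      (evalPoly (outputBlock P rows cols) z)).rank = Fintype.card n ∧
  (Matrix.fromCols (evalPoly (stateBlock P rows cols) z)
      (evalPoly (inputBlock P rows cols) z)).rank = Fintype.card n

/-- The partitioned matrix `P` is a linear polynomial system matrix (its entries have degree at
most one and its state matrix is nonsingular) that is a linearization of `G` at `z`: it is minimal
at `z`, and `R₁ diag(G, I_{s₁}) R₂ = diag(Ĝ, I_{s₂})` with `R₁, R₂` regular at `z`, where `Ĝ` is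
the transfer function matrix. The index sets here carry no order, so the two sides are compared
through bijections `e₁, e₂` of their row and column index sets; their choice is immaterial, because
permutation matrices can be absorbed in `R₁` and `R₂`. -/
def IsLinearizationAt {a b : Type*} [Fintype a] [DecidableEq a] [Fintype b] [DecidableEq b]
    [Fintype q] [Fintype s]
    (P : Matrix R S F[X]) (rows : n ⊕ q ≃ R) (cols : n ⊕ s ≃ S)
    (G : Matrix a b (RatFunc F)) (z : F) : Prop :=
  (∀ i j, (P i j).natDegree ≤ 1) ∧
  (stateBlock P rows cols).det ≠ 0 ∧
  MinimalAt P rows cols z ∧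
  ∃ s₁ s₂ : ℕ,
    (s₁ : ℤ) - s₂ = (Fintype.card q : ℤ) - Fintype.card a ∧
    (s₁ : ℤ) - s₂ = (Fintype.card s : ℤ) - Fintype.card b ∧
    ∃ (e₁ : a ⊕ Fin s₁ ≃ q ⊕ Fin s₂) (e₂ : b ⊕ Fin s₁ ≃ s ⊕ Fin s₂)
      (R₁ : Matrix (a ⊕ Fin s₁) (a ⊕ Fin s₁) (RatFunc F))
      (R₂ : Matrix (b ⊕ Fin s₁) (b ⊕ Fin s₁) (RatFunc F)),
      RegularAt R₁ z ∧ RegularAt R₂ z ∧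
      Matrix.reindex e₁ e₂
        (R₁ * (Matrix.fromBlocks G 0 0 1 : Matrix (a ⊕ Fin s₁) (b ⊕ Fin s₁) (RatFunc F)) * R₂) =
        Matrix.fromBlocks (transferFunction P rows cols) 0 0 1

/-- Linearization in a nonempty set `Ω ⊆ F`: linearization at each point of `Ω`. -/
def IsLinearizationIn {a b : Type*} [Fintype a] [DecidableEq a] [Fintype b] [DecidableEq b]
    [Fintype q] [Fintype s]
    (P : Matrix R S F[X]) (rows : n ⊕ q ≃ R) (cols : n ⊕ s ≃ S)
    (G : Matrix a b (RatFunc F)) (Ω : Set F) : Prop :=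
  Ω.Nonempty ∧ ∀ z ∈ Ω, IsLinearizationAt P rows cols G z

end SystemMatrix

/-! ### The low rank NLEIGS problem -/

/-- The parameters of the low rank NLEIGS problem. The sequences are indexed by `ℕ` for
convenience; only `σ 0, …, σ (N-1)`, `ξ 1, …, ξ N`, `β 0, …, β N`, `D 0, …, D p` and
`L (p+1), …, L N` are used. -/
structure LowRankData (F : Type*) (m r : ℕ) where
  /-- the nodes -/
  σ : ℕ → F
  /-- the poles, in `F ∪ {∞}` -/
  ξ : ℕ → OnePoint F
  /-- the scaling parameters -/
  β : ℕ → F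
  /-- the coefficients without low rank structure -/
  D : ℕ → Matrix (Fin m) (Fin m) F
  /-- the left factors of the low rank coefficients -/
  L : ℕ → Matrix (Fin m) (Fin r) F
  /-- the common right factor of the low rank coefficients -/
  U : Matrix (Fin m) (Fin r) F

/-- `1 / x` for `x ∈ F ∪ {∞}`, with `1 / ∞ = 0`. -/
def poleInv {F : Type*} [Field F] (x : OnePoint F) : F :=
  OnePoint.elim x 0 fun y : F => y⁻¹

namespace LowRankData

variable {F : Type*} [Field F] {m r : ℕ} (d : LowRankData F m r)

/-- `g_i = β_i (1 - λ / ξ_i)`. -/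
noncomputable def g (i : ℕ) : F[X] := C (d.β i) * (1 - C (poleInv (d.ξ i)) * X)

/-- `h_j = λ - σ_j`. -/
noncomputable def h (j : ℕ) : F[X] := X - C (d.σ j)

/-- `g_i` as a rational function. -/
noncomputable def gRat (i : ℕ) : RatFunc F := algebraMap F[X] (RatFunc F) (d.g i)

/-- `h_j` as a rational function. -/
noncomputable def hRat (j : ℕ) : RatFunc F := algebraMap F[X] (RatFunc F) (d.h j)

/-- `b_i = (1 / β_0) ∏_{k=1}^i (λ - σ_{k-1}) / (β_k (1 - λ / ξ_k))`. -/
noncomputable def b (i : ℕ) : RatFunc F :=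
  (RatFunc.C (d.β 0))⁻¹ * ∏ k ∈ Finset.Icc 1 i, d.hRat (k - 1) / d.gRat k

/-- `Q̃_N = ∑_{i=0}^p b_i D̃_i + ∑_{i=p+1}^N b_i L̃_i Ũᵀ`. -/
noncomputable def Q (N p : ℕ) : Matrix (Fin m) (Fin m) (RatFunc F) :=
  ∑ i ∈ Finset.Icc 0 p, d.b i • (d.D i).map RatFunc.C +
    ∑ i ∈ Finset.Icc (p + 1) N, d.b i • (d.L i * d.U.transpose).map RatFunc.C

/-- Index set of the state matrix: `p` blocks of size `m` and `N - 1 - p` blocks of size `r`.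
As rows, these are the block rows `0, …, N-2` of `K̃_N`; as columns, they are the block columns
`1, …, N-1` of `L̃_N`. -/
abbrev StateIdx (N p m r : ℕ) : Type := (Fin p × Fin m) ⊕ (Fin (N - 1 - p) × Fin r)

/-- Column index set of `L̃_N`: the block columns `0, …, p` of size `m`, followed by the block
columns `p+1, …, N-1` of size `r` (the latter are numbered from `0` here). -/
abbrev ColIdx (N p m r : ℕ) : Type := (Fin (p + 1) × Fin m) ⊕ (Fin (N - 1 - p) × Fin r)

/-- The first block row of the pencil,
`M̃_N = [(g_N/β_N) D̃_0, …, (g_N/β_N) D̃_p, (g_N/β_N) L̃_{p+1}, …, (g_N/β_N) L̃_{N-2},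
(g_N/β_N) L̃_{N-1} + (h_{N-1}/β_N) L̃_N]`. -/
noncomputable def M (N p : ℕ) : Matrix (Fin m) (ColIdx N p m r) F[X] :=
  Matrix.fromCols
    (Matrix.of fun a (jb : Fin (p + 1) × Fin m) =>
      C (d.β N)⁻¹ * d.g N * C (d.D jb.1 a jb.2))
    (Matrix.of fun a (jb : Fin (N - 1 - p) × Fin r) =>
      C (d.β N)⁻¹ * d.g N * C (d.L (p + 1 + jb.1) a jb.2) +
        if p + 1 + (jb.1 : ℕ) = N - 1 then C (d.β N)⁻¹ * d.h (N - 1) * C (d.L N a jb.2) else 0)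

/-- The remaining block rows `K̃_N` of the pencil. The block row `i < p` has the blocks `-h_i I_m`
and `g_{i+1} I_m` in the block columns `i` and `i + 1`. The block row `p` has `-h_p Ũᵀ` and
`g_{p+1} I_r` in the block columns `p` and `p + 1`. The block row `p + i`, for `i > 0`, has
`-h_{p+i} I_r` and `g_{p+i+1} I_r` in the block columns `p + i` and `p + i + 1`. -/
noncomputable def K (N p : ℕ) : Matrix (StateIdx N p m r) (ColIdx N p m r) F[X] :=
  Matrix.fromBlocks
    (Matrix.of fun (ia : Fin p × Fin m) (jb : Fin (p + 1) × Fin m) =>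
      if ia.2 = jb.2 then
        if (jb.1 : ℕ) = ia.1 then -d.h ia.1
        else if (jb.1 : ℕ) = ia.1 + 1 then d.g (ia.1 + 1)
        else 0
      else 0)
    0
    (Matrix.of fun (ia : Fin (N - 1 - p) × Fin r) (jb : Fin (p + 1) × Fin m) =>
      if (ia.1 : ℕ) = 0 ∧ (jb.1 : ℕ) = p then -d.h p * C (d.U jb.2 ia.2) else 0)
    (Matrix.of fun (ia : Fin (N - 1 - p) × Fin r) (jb : Fin (N - 1 - p) × Fin r) =>
      if ia.2 = jb.2 then
        if (jb.1 : ℕ) + 1 = ia.1 then -d.h (p + ia.1)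
        else if (jb.1 : ℕ) = ia.1 then d.g (p + ia.1 + 1)
        else 0
      else 0)

/-- The pencil `L̃_N = [M̃_N; K̃_N]`. -/
noncomputable def pencil (N p : ℕ) : Matrix (Fin m ⊕ StateIdx N p m r) (ColIdx N p m r) F[X] :=
  Matrix.fromRows (d.M N p) (d.K N p)

/-- The block columns `1, …, N-1`, i.e. all of them but the first one. -/
def tailCol (N p m r : ℕ) : StateIdx N p m r → ColIdx N p m r :=
  Sum.map (Prod.map Fin.succ id) id

/-- The matrix `Ã_N`, obtained from `K̃_N` by removing the first block column. -/
noncomputable def A (N p : ℕ) : Matrix (StateIdx N p m r) (StateIdx N p m r) F[X] :=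
  (d.K N p).submatrix id (tailCol N p m r)

/-- The partition of the rows of `L̃_N`: those of `K̃_N` are the rows of the state matrix. -/
def rowPartition (N p m r : ℕ) : StateIdx N p m r ⊕ Fin m ≃ Fin m ⊕ StateIdx N p m r :=
  Equiv.sumComm _ _

/-- The partition of the columns of `L̃_N`: all block columns but the first one are those of the
state matrix. -/
def colPartition (N p m r : ℕ) : StateIdx N p m r ⊕ Fin m ≃ ColIdx N p m r where
  toFun := Sum.elim (tailCol N p m r) fun c => Sum.inl (0, c)
  invFun
    | Sum.inl (j, c) => Fin.cases (Sum.inr c) (fun i => Sum.inl (Sum.inl (i, c))) j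
    | Sum.inr x => Sum.inl (Sum.inr x)
  left_inv := by rintro ((⟨i, c⟩ | x) | c) <;> rfl
  right_inv := by
    rintro (⟨j, c⟩ | x)
    · refine Fin.cases ?_ (fun i => ?_) j <;> rfl
    · rfl

/-- `R̃_N^{(1)} = (g_N / h_{N-1}) (∑_{j=1}^{p-1} (∏_{k=j+1}^p g_k / h_{k-1}) D̃_j + D̃_p)`. -/
noncomputable def R1 (N p : ℕ) : Matrix (Fin m) (Fin m) (RatFunc F) :=
  (d.gRat N / d.hRat (N - 1)) •
    (∑ j ∈ Finset.Icc 1 (p - 1),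
      (∏ k ∈ Finset.Icc (j + 1) p, d.gRat k / d.hRat (k - 1)) • (d.D j).map RatFunc.C +
      (d.D p).map RatFunc.C)

/-- `R̃_N^{(2)} = ∑_{j=p+1}^{N-1} (∏_{k=j+1}^N g_k / h_{k-1}) L̃_j + L̃_N`. -/
noncomputable def R2 (N p : ℕ) : Matrix (Fin m) (Fin r) (RatFunc F) :=
  ∑ j ∈ Finset.Icc (p + 1) (N - 1),
    (∏ k ∈ Finset.Icc (j + 1) N, d.gRat k / d.hRat (k - 1)) • (d.L j).map RatFunc.C +
    (d.L N).map RatFunc.C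

/-- The `(2m + r) × (m + r)` rational matrix `R̃_N`, with block rows `[R̃_N^{(1)}, R̃_N^{(2)}]`,
`[(∏_{i=1}^{p-1} g_i / h_i) g_p I_m, 0]` and
`[-h_p Ũᵀ, (∏_{i=p+1}^{N-2} g_i / h_i) g_{N-1} I_r]`. -/
noncomputable def R (N p : ℕ) :
    Matrix (Fin m ⊕ (Fin m ⊕ Fin r)) (Fin m ⊕ Fin r) (RatFunc F) :=
  Matrix.fromRows
    (Matrix.fromCols (d.R1 N p) (d.R2 N p))
    (Matrix.fromBlocks
      (((∏ i ∈ Finset.Icc 1 (p - 1), d.gRat i / d.hRat i) * d.gRat p) • 1)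
      0
      (-d.hRat p • d.U.transpose.map RatFunc.C)
      (((∏ i ∈ Finset.Icc (p + 1) (N - 2), d.gRat i / d.hRat i) * d.gRat (N - 1)) • 1))

end LowRankData

end NLEIGS

/-!
The first block column of `L̃_N` belongs to the blocks `B` and `D`, so the columns of `[-A⁻¹B; I]`
form the right kernel of `K̃_N` normalized by an identity in the first block. Because `K̃_N` is
bidiagonal, this kernel is given by a two-term recurrence whose solution is `β_0 b_0 I, …, β_0 b_p I,
β_0 b_{p+1} Ũᵀ, …, β_0 b_{N-1} Ũᵀ`. Multiplying it by `M̃_N`, and using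
`h_{N-1} b_{N-1} = g_N b_N` for the last coefficient, gives
the transfer function `(β_0 g_N / β_N) Q̃_N` (`transferFunction_pencil`). Hence the equivalence with
`Q̃_N` holds with `R₁` a scalar matrix, `R₂ = I` and `s₁ = s₂ = 0` wherever `g_N` does not vanish,
that is, away from `ξ_N`.

Minimality holds at every point `z` (`minimalAt_pencil`). As poles and nodes are distinct, the `g_i`
and the `h_j` do not vanish simultaneously.

* The rows of `K̃_N(z)` are independent: the blocks of a left kernel vector vanish successively,
  starting at the first one if no `h_j` vanishes and at the last one if no `g_i` vanishes. The
  passage through the block `Ũ` uses its full column rank (`stateVec_eq_zero_of_vecMul_eq_zero`).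
* Let a right kernel vector of `L̃_N(z)` have first block zero. If no `g_i` with `i < N` vanishes,
  then forward substitution shows that it is zero (`IsStateKernel.blockVec_eq_zero_of_g_ne_zero`).
  Otherwise `z` is some `ξ_k` with `k < N` and no `h_j` vanishes. Backward substitution then expresses
  the vector through its blocks `p` and `N - 1`, and the remaining equations say exactly that
  `R̃_N(ξ_k)` annihilates these two blocks, so they vanish by the rank assumption
  (`IsStateKernel.blockVec_eq_zero_of_rank_R`).
-/

namespace NLEIGS

open Polynomial

/-! ### Full rank and trivial kernels -/

theorem mulVec_eq_zero_of_rank_eq_card {K ι κ : Type*} [Field K] [Fintype κ]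
    {B : Matrix ι κ K} (hB : B.rank = Fintype.card κ) {v : κ → K} (hv : B.mulVec v = 0) :
    v = 0 := by
  classical
  have h := LinearMap.finrank_range_add_finrank_ker B.mulVecLin
  rw [← Matrix.rank, hB, Module.finrank_fintype_fun_eq_card] at h
  have hker : LinearMap.ker B.mulVecLin = ⊥ := Submodule.finrank_eq_zero.1 (by omega)
  have hmem : v ∈ LinearMap.ker B.mulVecLin := by simpa using hv
  simpa [hker] using hmem

theorem rank_eq_card_of_mulVec_eq_zero {K ι κ : Type*} [Field K] [Fintype κ]
    {B : Matrix ι κ K} (hB : ∀ v : κ → K, B.mulVec v = 0 → v = 0) :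
    B.rank = Fintype.card κ := by
  classical
  have h := LinearMap.finrank_range_add_finrank_ker B.mulVecLin
  have hker : LinearMap.ker B.mulVecLin = ⊥ := LinearMap.ker_eq_bot'.2 hB
  rwa [hker, finrank_bot, add_zero, Module.finrank_fintype_fun_eq_card] at h

/-! ### Values of rational functions -/

/-- The rational function `f` is defined at `z` and takes the value `c` there. -/
def HasValueAt {F : Type*} [Field F] (z : F) (f : RatFunc F) (c : F) : Prop :=
  f.denom.eval z ≠ 0 ∧ f.eval (RingHom.id F) z = c

namespace HasValueAt

variable {F : Type*} [Field F] {z : F}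

theorem eval_eq {f : RatFunc F} {c : F} (hf : HasValueAt z f c) :
    f.eval (RingHom.id F) z = c :=
  hf.2

theorem add {f g : RatFunc F} {a b : F} (hf : HasValueAt z f a) (hg : HasValueAt z g b) :
    HasValueAt z (f + g) (a + b) := by
  refine ⟨fun h => ?_, ?_⟩
  · have := Polynomial.eval_eq_zero_of_dvd_of_eval_eq_zero (RatFunc.denom_add_dvd f g) h
    simp [hf.1, hg.1] at this
  · rw [RatFunc.eval_add _ _ hf.1 hg.1, hf.2, hg.2]

theorem mul {f g : RatFunc F} {a b : F} (hf : HasValueAt z f a) (hg : HasValueAt z g b) :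
    HasValueAt z (f * g) (a * b) := by
  refine ⟨fun h => ?_, ?_⟩
  · have := Polynomial.eval_eq_zero_of_dvd_of_eval_eq_zero (RatFunc.denom_mul_dvd f g) h
    simp [hf.1, hg.1] at this
  · rw [RatFunc.eval_mul _ _ hf.1 hg.1, hf.2, hg.2]

theorem algebraMap (q : F[X]) : HasValueAt z (algebraMap F[X] (RatFunc F) q) (q.eval z) :=
  ⟨by simp, by simp⟩

theorem const (a : F) : HasValueAt z (RatFunc.C a) a := ⟨by simp, by simp⟩

theorem zero : HasValueAt z (0 : RatFunc F) 0 := ⟨by simp, by simp⟩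

theorem one : HasValueAt z (1 : RatFunc F) 1 := ⟨by simp, by simp⟩

theorem neg {f : RatFunc F} {a : F} (hf : HasValueAt z f a) : HasValueAt z (-f) (-a) := by
  simpa using (const (-1)).mul hf

theorem inv {f : RatFunc F} {a : F} (hf : HasValueAt z f a) (ha : a ≠ 0) :
    HasValueAt z f⁻¹ a⁻¹ := by
  have hf0 : f ≠ 0 := by
    rintro rfl
    exact ha (hf.2.symm.trans (by simp))
  have hden : f⁻¹.denom.eval z ≠ 0 := fun h => by
    have hnum := Polynomial.eval_eq_zero_of_dvd_of_eval_eq_zero (RatFunc.denom_inv_dvd hf0) h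
    refine ha (hf.2.symm.trans ?_)
    rw [RatFunc.eval, ← Polynomial.eval, hnum, zero_div]
  refine ⟨hden, eq_inv_of_mul_eq_one_right ?_⟩
  have := RatFunc.eval_mul (RingHom.id F) z hf.1 hden
  rwa [mul_inv_cancel₀ hf0, RatFunc.eval_one, hf.2, eq_comm] at this

theorem div {f g : RatFunc F} {a b : F} (hf : HasValueAt z f a) (hg : HasValueAt z g b)
    (hb : b ≠ 0) : HasValueAt z (f / g) (a / b) := by
  rw [div_eq_mul_inv, div_eq_mul_inv]
  exact hf.mul (hg.inv hb)

theorem sum {ι : Type*} (s : Finset ι) {f : ι → RatFunc F} {a : ι → F}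
    (h : ∀ i ∈ s, HasValueAt z (f i) (a i)) : HasValueAt z (∑ i ∈ s, f i) (∑ i ∈ s, a i) := by
  classical
  induction s using Finset.induction_on with
  | empty => simpa using zero
  | insert i s hi ih =>
    rw [Finset.sum_insert hi, Finset.sum_insert hi]
    exact (h i (by simp)).add (ih fun j hj => h j (by simp [hj]))

theorem prod {ι : Type*} (s : Finset ι) {f : ι → RatFunc F} {a : ι → F}
    (h : ∀ i ∈ s, HasValueAt z (f i) (a i)) : HasValueAt z (∏ i ∈ s, f i) (∏ i ∈ s, a i) := by
  classical
  induction s using Finset.induction_on with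
  | empty => simpa using one
  | insert i s hi ih =>
    rw [Finset.prod_insert hi, Finset.prod_insert hi]
    exact (h i (by simp)).mul (ih fun j hj => h j (by simp [hj]))

end HasValueAt

theorem hasValueAt_smul_one {F ι : Type*} [Field F] [DecidableEq ι] {z : F} {f : RatFunc F} {c : F}
    (hf : HasValueAt z f c) (i j : ι) :
    HasValueAt z ((f • (1 : Matrix ι ι (RatFunc F))) i j) ((c • (1 : Matrix ι ι F)) i j) := by
  by_cases h : i = j
  · simpa [h] using hf
  · simpa [h] using HasValueAt.zero

/-- A polynomial multiple of the identity is regular wherever the polynomial does not vanish. -/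
theorem regularAt_algebraMap_smul_one {F ι : Type*} [Field F] [Fintype ι] [DecidableEq ι]
    {c : F[X]} {z : F} (hc : c.eval z ≠ 0) :
    RegularAt (algebraMap F[X] (RatFunc F) c • (1 : Matrix ι ι (RatFunc F))) z := by
  have hval := hasValueAt_smul_one (ι := ι) (HasValueAt.algebraMap (z := z) c)
  refine ⟨fun i j => (hval i j).1, ?_⟩
  have : evalRat (algebraMap F[X] (RatFunc F) c • (1 : Matrix ι ι (RatFunc F))) z =
      c.eval z • 1 := Matrix.ext fun i j => (hval i j).2
  rw [this, Matrix.det_smul, Matrix.det_one, mul_one]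
  exact pow_ne_zero _ hc

/-! ### Partitioned polynomial system matrices -/

section SystemMatrix

variable {F R S n q s : Type*} [Field F] [Fintype n]

theorem map_mulVec_apply_partition {K : Type*} [CommRing K] [Fintype S] [Fintype s]
    (φ : F[X] →+* K) (P : Matrix R S F[X]) (cols : n ⊕ s ≃ S) (w : S → K) (i : R) :
    (P.map φ).mulVec w i =
      ∑ j, φ (P i (cols (Sum.inl j))) * w (cols (Sum.inl j)) +
        ∑ j, φ (P i (cols (Sum.inr j))) * w (cols (Sum.inr j)) := by
  simp only [Matrix.mulVec, dotProduct, Matrix.map_apply]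
  rw [← Equiv.sum_comp cols, Fintype.sum_sum_type]

theorem evalPoly_eq_map (P : Matrix R S F[X]) (z : F) :
    evalPoly P z = P.map (evalRingHom z) := rfl

/-- Minimality expressed through kernels of the unpartitioned matrix: the right kernel of `P(z)`
meets the state columns trivially, and the left kernel meets the state rows trivially. -/
theorem minimalAt_of_kernels [Fintype R] [Fintype S] [Fintype q] [Fintype s]
    (P : Matrix R S F[X]) (rows : n ⊕ q ≃ R) (cols : n ⊕ s ≃ S) (z : F)
    (hright : ∀ w : S → F, (∀ j, w (cols (Sum.inr j)) = 0) → (evalPoly P z).mulVec w = 0 → w = 0)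
    (hleft : ∀ y : R → F, (∀ i, y (rows (Sum.inr i)) = 0) →
      Matrix.vecMul y (evalPoly P z) = 0 → y = 0) :
    MinimalAt P rows cols z := by
  constructor
  · refine rank_eq_card_of_mulVec_eq_zero fun v hv => ?_
    have hw := hright (Sum.elim v 0 ∘ cols.symm) (by simp) <| by
      funext i
      obtain ⟨i, rfl⟩ := rows.surjective i
      rw [evalPoly_eq_map, map_mulVec_apply_partition _ _ cols]
      rcases i with i | i
      · simpa [Matrix.mulVec, dotProduct, evalPoly, stateBlock] using congrFun hv (Sum.inl i)
      · simpa [Matrix.mulVec, dotProduct, evalPoly, outputBlock] using congrFun hv (Sum.inr i)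
    funext j
    simpa using congrFun hw (cols (Sum.inl j))
  · rw [← Matrix.rank_transpose]
    refine rank_eq_card_of_mulVec_eq_zero fun v hv => ?_
    have hw := hleft (Sum.elim v 0 ∘ rows.symm) (by simp) <| by
      funext j
      obtain ⟨j, rfl⟩ := cols.surjective j
      rw [← Matrix.mulVec_transpose, evalPoly_eq_map, ← Matrix.transpose_map,
        map_mulVec_apply_partition _ _ rows]
      rcases j with j | j
      · simpa [Matrix.mulVec, dotProduct, evalPoly, stateBlock] using congrFun hv (Sum.inl j)
      · simpa [Matrix.mulVec, dotProduct, evalPoly, inputBlock] using congrFun hv (Sum.inr j)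
    funext j
    simpa using congrFun hw (rows (Sum.inl j))

variable [DecidableEq n]

/-- The state matrix is nonsingular if, at some point `z`, the state rows of `P(z)` annihilate no
nonzero vector supported on the state columns. -/
theorem det_stateBlock_ne_zero [Fintype S] [Fintype s] (P : Matrix R S F[X]) (rows : n ⊕ q ≃ R)
    (cols : n ⊕ s ≃ S) (z : F)
    (h : ∀ w : S → F, (∀ j, w (cols (Sum.inr j)) = 0) →
      (∀ i, (evalPoly P z).mulVec w (rows (Sum.inl i)) = 0) → w = 0) :
    (stateBlock P rows cols).det ≠ 0 := by
  intro hdet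
  have h0 : (evalPoly (stateBlock P rows cols) z).det = 0 := by
    rw [evalPoly_eq_map, ← RingHom.mapMatrix_apply, ← RingHom.map_det, hdet, map_zero]
  obtain ⟨v, hv, hv0⟩ := Matrix.exists_mulVec_eq_zero_iff.2 h0
  refine hv ?_
  have hw := h (Sum.elim v 0 ∘ cols.symm) (by simp) fun i => by
    rw [evalPoly_eq_map, map_mulVec_apply_partition _ _ cols]
    simpa [Matrix.mulVec, dotProduct, evalPoly, stateBlock] using congrFun hv0 i
  funext j
  simpa using congrFun hw (cols (Sum.inl j))

/-- If `W` has columns annihilated by the state rows `[A, B]` of `P` and its block in the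
non-state coordinates is the identity, then `W = [-A⁻¹B; I]`, so that the remaining rows of `P`
map `W` to the transfer function `D + C A⁻¹ B`. -/
theorem transferFunction_eq_mul [Fintype S] [Fintype s] [DecidableEq s]
    (P : Matrix R S F[X]) (rows : n ⊕ q ≃ R) (cols : n ⊕ s ≃ S)
    (hdet : (stateBlock P rows cols).det ≠ 0) (W : Matrix S s (RatFunc F))
    (hW : ∀ i j, (toRat P * W) (rows (Sum.inl i)) j = 0)
    (hid : ∀ i j, W (cols (Sum.inr i)) j = (1 : Matrix s s (RatFunc F)) i j) :
    transferFunction P rows cols = (toRat P * W).submatrix (fun i => rows (Sum.inr i)) id := by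
  have hmul : ∀ i j, (toRat P * W) i j =
      ∑ k, algebraMap F[X] (RatFunc F) (P i (cols (Sum.inl k))) * W (cols (Sum.inl k)) j +
        algebraMap F[X] (RatFunc F) (P i (cols (Sum.inr j))) := fun i j => by
    have h := map_mulVec_apply_partition (algebraMap F[X] (RatFunc F)) P cols
      (fun k => W k j) i
    simp only [hid, Matrix.one_apply, mul_ite, mul_one, mul_zero, Finset.sum_ite_eq',
      Finset.mem_univ, if_true] at h
    exact h
  set V : Matrix n s (RatFunc F) := W.submatrix (fun k => cols (Sum.inl k)) id with hV
  have hAV : toRat (stateBlock P rows cols) * V = -toRat (inputBlock P rows cols) := by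
    ext i j
    have h := hW i j
    rw [hmul] at h
    exact eq_neg_of_add_eq_zero_left h
  have hunit : IsUnit (toRat (stateBlock P rows cols)).det := by
    rw [toRat, ← RingHom.mapMatrix_apply, ← RingHom.map_det, isUnit_iff_ne_zero]
    exact fun h0 => hdet ((map_eq_zero_iff _ (RatFunc.algebraMap_injective F)).1 h0)
  have hsol : (toRat (stateBlock P rows cols))⁻¹ * toRat (inputBlock P rows cols) = -V := by
    rw [← neg_neg (toRat (inputBlock P rows cols)), ← hAV, Matrix.mul_neg,
      Matrix.nonsing_inv_mul_cancel_left _ _ hunit]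
  rw [transferFunction, Matrix.mul_assoc, hsol]
  ext i j
  rw [Matrix.submatrix_apply, hmul, add_comm]
  simp [Matrix.mul_apply, toRat, outputBlock, directBlock, hV]

/-- If the transfer function is a polynomial multiple `c • G` of `G` and `c` does not vanish at
`z`, then the equivalence required of a linearization holds at `z` with `R₁ = c I`, `R₂ = I` and
no identity blocks. -/
theorem isLinearizationAt_of_transferFunction_eq_smul [DecidableEq q] [DecidableEq s]
    [Fintype q] [Fintype s]
    (P : Matrix R S F[X]) (rows : n ⊕ q ≃ R) (cols : n ⊕ s ≃ S)
    (G : Matrix q s (RatFunc F)) (z : F) (hdeg : ∀ i j, (P i j).natDegree ≤ 1)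
    (hdet : (stateBlock P rows cols).det ≠ 0) (hmin : MinimalAt P rows cols z)
    (c : F[X]) (hc : c.eval z ≠ 0)
    (hG : transferFunction P rows cols = algebraMap F[X] (RatFunc F) c • G) :
    IsLinearizationAt P rows cols G z := by
  refine ⟨hdeg, hdet, hmin, 0, 0, by simp, by simp, Equiv.refl _, Equiv.refl _,
    algebraMap F[X] (RatFunc F) c • 1, 1, regularAt_algebraMap_smul_one hc, ?_, ?_⟩
  · simpa using regularAt_algebraMap_smul_one (F := F) (ι := s ⊕ Fin 0) (c := 1) (z := z)
  · rw [hG, Matrix.mul_one, Matrix.smul_mul, Matrix.one_mul, Matrix.fromBlocks_smul]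
    ext (i | i) (j | j)
    · simp
    · exact j.elim0
    · exact i.elim0
    · exact i.elim0

end SystemMatrix

/-! ### Sums, products and two-term recurrences -/

theorem sum_Icc_eq_sum_range {M : Type*} [AddCommMonoid M] (f : ℕ → M) (a n : ℕ) :
    ∑ i ∈ Finset.Icc a n, f i = ∑ i ∈ Finset.range (n + 1 - a), f (a + i) := by
  rw [← Finset.sum_Ico_eq_sum_range]
  exact Finset.sum_congr (by ext; simp) fun _ _ => rfl

theorem prod_Icc_eq_mul_prod_Icc_succ {M : Type*} [CommMonoid M] (f : ℕ → M) {a b : ℕ}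
    (h : a ≤ b) : ∏ i ∈ Finset.Icc a b, f i = f a * ∏ i ∈ Finset.Icc (a + 1) b, f i := by
  rw [← Finset.mul_prod_Ioc_eq_prod_Icc h]
  exact congrArg _ (Finset.prod_congr (by ext; simp) fun _ _ => rfl)

/-- Shifting the denominators of a telescoping product by one index. -/
theorem prod_Icc_div_mul {K : Type*} [Field K] (g h : ℕ → K) (a c : ℕ) (hac : a + 1 ≤ c) :
    (∏ i ∈ Finset.Icc (a + 1) (c - 1), g i / h i) * g c =
      g (a + 1) * ∏ k ∈ Finset.Icc (a + 2) c, g k / h (k - 1) := by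
  induction c, hac using Nat.le_induction with
  | base => simp
  | succ c hc ih =>
    obtain ⟨c, rfl⟩ : ∃ c', c = c' + 1 := ⟨c - 1, by omega⟩
    rw [Nat.add_sub_cancel] at ih ⊢
    rw [Finset.prod_Icc_succ_top (by omega), Finset.prod_Icc_succ_top (by omega), ← mul_assoc,
      ← ih, Nat.add_sub_cancel]
    ring

/-- A sequence of vectors with `h i • x i = g (i + 1) • x (i + 1)` is determined by its last
term. -/
theorem eq_prod_smul_of_recurrence {K V : Type*} [Field K] [AddCommGroup V] [Module K V]
    (g h : ℕ → K) (x : ℕ → V) (a n : ℕ) (hh : ∀ i, a ≤ i → i < n → h i ≠ 0)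
    (hx : ∀ i, a ≤ i → i < n → h i • x i = g (i + 1) • x (i + 1)) (i : ℕ) (hai : a ≤ i)
    (hin : i ≤ n) : x i = (∏ k ∈ Finset.Icc (i + 1) n, g k / h (k - 1)) • x n := by
  induction hin using Nat.decreasingInduction with
  | self => simp
  | of_succ i hi ih =>
    rw [prod_Icc_eq_mul_prod_Icc_succ _ (Nat.succ_le_of_lt hi), mul_smul, ← ih (by omega),
      div_eq_inv_mul, mul_smul, Nat.succ_eq_add_one, Nat.add_sub_cancel, ← hx i hai hi,
      inv_smul_smul₀ (hh i hai hi)]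

namespace LowRankData

variable {F : Type*} [Field F] {m r : ℕ} (d : LowRankData F m r)

/-! ### The action of the pencil on block vectors -/

/-- The vector with block `x j` in the block column `j ≤ p` and block `y i` in the block column
`p + 1 + i`. The blocks are given as sequences; those out of range are ignored. -/
def blockVec {K : Type*} (N p : ℕ) (x : ℕ → Fin m → K) (y : ℕ → Fin r → K) :
    ColIdx N p m r → K :=
  Sum.elim (fun jb => x jb.1 jb.2) (fun jb => y jb.1 jb.2)

/-- The vector on the rows of `K̃_N` with blocks `u 0, …, u (p-1)`, `v 0, …, v (N-2-p)`. -/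
def stateVec {K : Type*} (N p : ℕ) (u : ℕ → Fin m → K) (v : ℕ → Fin r → K) :
    StateIdx N p m r → K :=
  Sum.elim (fun jb => u jb.1 jb.2) (fun jb => v jb.1 jb.2)

theorem exists_eq_blockVec {K : Type*} [Zero K] {N p : ℕ} (w : ColIdx N p m r → K) :
    ∃ x y, w = blockVec N p x y :=
  ⟨fun j b => if h : j < p + 1 then w (Sum.inl (⟨j, h⟩, b)) else 0,
    fun j b => if h : j < N - 1 - p then w (Sum.inr (⟨j, h⟩, b)) else 0, by
      ext (⟨j, b⟩ | ⟨j, b⟩)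
      · simp only [blockVec, Sum.elim_inl, j.2, dif_pos]
      · simp only [blockVec, Sum.elim_inr, j.2, dif_pos]⟩

/-- Every vector on the rows of `K̃_N` comes from sequences of blocks that vanish out of range. -/
theorem exists_eq_stateVec {K : Type*} [Zero K] {N p : ℕ} (w : StateIdx N p m r → K) :
    ∃ u v, w = stateVec N p u v ∧ (∀ j, p ≤ j → u j = 0) ∧ ∀ j, N - 1 - p ≤ j → v j = 0 :=
  ⟨fun j b => if h : j < p then w (Sum.inl (⟨j, h⟩, b)) else 0,
    fun j b => if h : j < N - 1 - p then w (Sum.inr (⟨j, h⟩, b)) else 0, by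
      ext (⟨j, b⟩ | ⟨j, b⟩)
      · simp only [stateVec, Sum.elim_inl, j.2, dif_pos]
      · simp only [stateVec, Sum.elim_inr, j.2, dif_pos],
    fun j hj => funext fun b => dif_neg (by omega),
    fun j hj => funext fun b => dif_neg (by omega)⟩

section Action

variable {K : Type*} [CommRing K] (φ : F[X] →+* K) (N p : ℕ)
  (x : ℕ → Fin m → K) (y : ℕ → Fin r → K)

theorem pencil_mulVec_state_inl (i : Fin p) (a : Fin m) :
    ((d.pencil N p).map φ).mulVec (blockVec N p x y) (Sum.inr (Sum.inl (i, a))) =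
      φ (d.g (i + 1)) * x (i + 1) a - φ (d.h i) * x i a := by
  have hsplit : ∀ j : ℕ, (if j = i then φ (-d.h i) * x j a else
      if j = i + 1 then φ (d.g (i + 1)) * x j a else 0) =
      (if j = i then -φ (d.h i) * x j a else 0) +
        if j = i + 1 then φ (d.g (i + 1)) * x j a else 0 := fun j => by
    by_cases h : j = i
    · simp [h]
    · simp [h]
  have hi : (i : ℕ) < p + 1 := by omega
  have hi' : (i : ℕ) + 1 < p + 1 := by omega
  simp only [Matrix.mulVec, dotProduct, Fintype.sum_sum_type, Fintype.sum_prod_type, pencil,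
    LowRankData.K, blockVec, Matrix.map_apply, Matrix.fromRows_apply_inr,
    Matrix.fromBlocks_apply₁₁, Matrix.fromBlocks_apply₁₂, Matrix.of_apply, Sum.elim_inl,
    Sum.elim_inr, Matrix.zero_apply, map_zero, zero_mul, Finset.sum_const_zero, add_zero,
    apply_ite φ, ite_mul, Finset.sum_ite_eq, Finset.mem_univ, if_true]
  rw [Fin.sum_univ_eq_sum_range (fun j => if j = (i : ℕ) then φ (-d.h i) * x j a else
    if j = i + 1 then φ (d.g (i + 1)) * x j a else 0)]
  simp only [hsplit, Finset.sum_add_distrib, Finset.sum_ite_eq', Finset.mem_range, hi, hi',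
    if_true]
  ring

theorem pencil_mulVec_state_inr_zero (h0 : 0 < N - 1 - p) (c : Fin r) :
    ((d.pencil N p).map φ).mulVec (blockVec N p x y) (Sum.inr (Sum.inr (⟨0, h0⟩, c))) =
      φ (d.g (p + 1)) * y 0 c - φ (d.h p) * ∑ b, φ (C (d.U b c)) * x p b := by
  simp only [Matrix.mulVec, dotProduct, Fintype.sum_sum_type, Fintype.sum_prod_type, pencil,
    LowRankData.K, blockVec, Matrix.map_apply, Matrix.fromRows_apply_inr,
    Matrix.fromBlocks_apply₂₁, Matrix.fromBlocks_apply₂₂, Matrix.of_apply, Sum.elim_inl,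
    Sum.elim_inr, map_zero, zero_mul, true_and, add_zero, Nat.add_one_ne_zero, if_false,
    apply_ite φ, ite_mul, Finset.sum_ite_eq, Finset.mem_univ, if_true]
  rw [Fin.sum_univ_eq_sum_range (fun j => ∑ b, if j = p then φ (-d.h p * C (d.U b c)) * x j b
    else 0), Fin.sum_univ_eq_sum_range (fun j => if j = 0 then φ (d.g (p + 1)) * y j c else 0),
    Finset.sum_comm]
  simp only [Finset.sum_ite_eq', Finset.mem_range, Nat.lt_succ_self, h0, if_true, map_mul,
    map_neg, Finset.mul_sum]
  rw [add_comm, sub_eq_add_neg, ← Finset.sum_neg_distrib]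
  exact congrArg _ (Finset.sum_congr rfl fun b _ => by ring)

theorem pencil_mulVec_state_inr_succ (i : ℕ) (hi : i + 1 < N - 1 - p) (c : Fin r) :
    ((d.pencil N p).map φ).mulVec (blockVec N p x y) (Sum.inr (Sum.inr (⟨i + 1, hi⟩, c))) =
      φ (d.g (p + 1 + (i + 1))) * y (i + 1) c - φ (d.h (p + 1 + i)) * y i c := by
  have hsplit : ∀ j : ℕ, (if j + 1 = i + 1 then φ (-d.h (p + (i + 1))) * y j c else
      if j = i + 1 then φ (d.g (p + (i + 1) + 1)) * y j c else 0) =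
      (if j = i then -φ (d.h (p + (i + 1))) * y j c else 0) +
        if j = i + 1 then φ (d.g (p + (i + 1) + 1)) * y j c else 0 := fun j => by
    by_cases h : j = i
    · simp [h]
    · simp [h]
  have hi' : i < N - 1 - p := by omega
  simp only [Matrix.mulVec, dotProduct, Fintype.sum_sum_type, Fintype.sum_prod_type, pencil,
    LowRankData.K, blockVec, Matrix.map_apply, Matrix.fromRows_apply_inr,
    Matrix.fromBlocks_apply₂₁, Matrix.fromBlocks_apply₂₂, Matrix.of_apply, Sum.elim_inl,
    Sum.elim_inr, map_zero, zero_mul, Nat.add_one_ne_zero, false_and, if_false,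
    Finset.sum_const_zero, zero_add,
    apply_ite φ, ite_mul, Finset.sum_ite_eq, Finset.mem_univ, if_true]
  rw [Fin.sum_univ_eq_sum_range (fun j => if j + 1 = i + 1 then φ (-d.h (p + (i + 1))) * y j c
    else if j = i + 1 then φ (d.g (p + (i + 1) + 1)) * y j c else 0)]
  simp only [hsplit, Finset.sum_add_distrib, Finset.sum_ite_eq', Finset.mem_range, hi, hi',
    if_true]
  rw [show p + (i + 1) + 1 = p + 1 + (i + 1) by omega, show p + (i + 1) = p + 1 + i by omega]
  ring

theorem pencil_mulVec_output (hN : p + 2 ≤ N) (a : Fin m) :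
    ((d.pencil N p).map φ).mulVec (blockVec N p x y) (Sum.inl a) =
      φ (C (d.β N)⁻¹) * (φ (d.g N) *
        (∑ j ∈ Finset.range (p + 1), ∑ b, φ (C (d.D j a b)) * x j b +
          ∑ j ∈ Finset.range (N - 1 - p), ∑ c, φ (C (d.L (p + 1 + j) a c)) * y j c) +
        φ (d.h (N - 1)) * ∑ c, φ (C (d.L N a c)) * y (N - 2 - p) c) := by
  have hlast : ∀ j : ℕ, p + 1 + j = N - 1 ↔ j = N - 2 - p := fun j => by omega
  have hmem : N - 2 - p < N - 1 - p := by omega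
  simp only [Matrix.mulVec, dotProduct, Fintype.sum_sum_type, Fintype.sum_prod_type, pencil,
    LowRankData.M, blockVec, Matrix.map_apply, Matrix.fromRows_apply_inl,
    Matrix.fromCols_apply_inl, Matrix.fromCols_apply_inr, Matrix.of_apply, Sum.elim_inl,
    Sum.elim_inr, hlast, map_add, map_mul, apply_ite φ, map_zero, add_mul, ite_mul, zero_mul,
    Finset.sum_add_distrib]
  rw [Fin.sum_univ_eq_sum_range (fun j => ∑ b, φ (C (d.β N)⁻¹) * φ (d.g N) * φ (C (d.D j a b)) *
      x j b), Fin.sum_univ_eq_sum_range (fun j => ∑ c, φ (C (d.β N)⁻¹) * φ (d.g N) *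
      φ (C (d.L (p + 1 + j) a c)) * y j c), Fin.sum_univ_eq_sum_range (fun j => ∑ c,
      if j = N - 2 - p then φ (C (d.β N)⁻¹) * φ (d.h (N - 1)) * φ (C (d.L N a c)) * y j c else 0),
    Finset.sum_comm (s := Finset.range (N - 1 - p)) (t := Finset.univ)
      (f := fun j c => if j = N - 2 - p then φ (C (d.β N)⁻¹) * φ (d.h (N - 1)) *
        φ (C (d.L N a c)) * y j c else 0)]
  simp only [Finset.sum_ite_eq', Finset.mem_range, hmem, if_true, mul_add, Finset.mul_sum,
    mul_assoc, add_assoc]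

variable (u : ℕ → Fin m → K) (v : ℕ → Fin r → K)

theorem vecMul_pencil_zero (hp : 1 ≤ p) (b : Fin m) :
    Matrix.vecMul (Sum.elim 0 (stateVec N p u v)) ((d.pencil N p).map φ) (Sum.inl (0, b)) =
      -(φ (d.h 0) * u 0 b) := by
  have hp0 : 0 < p := hp
  simp only [Matrix.vecMul, dotProduct, Fintype.sum_sum_type, Fintype.sum_prod_type, pencil,
    LowRankData.K, stateVec, Matrix.map_apply, Matrix.fromRows_apply_inr,
    Matrix.fromBlocks_apply₁₁, Matrix.fromBlocks_apply₂₁, Matrix.of_apply, Sum.elim_inl,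
    Sum.elim_inr, Pi.zero_apply, zero_mul, Finset.sum_const_zero, zero_add, Fin.val_zero,
    hp0.ne, and_false, if_false, (Nat.succ_ne_zero _).symm,
    apply_ite φ, map_zero, mul_ite, mul_zero, add_zero, Finset.sum_ite_eq', Finset.mem_univ,
    if_true]
  rw [Fin.sum_univ_eq_sum_range (fun i => if 0 = i then u i b * φ (-d.h i) else 0)]
  simp only [Finset.sum_ite_eq, Finset.mem_range, hp0, if_true, map_neg]
  ring

theorem vecMul_pencil_succ (hN : p + 2 ≤ N) (hu : u p = 0) (j : ℕ) (hj : j + 1 < p + 1)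
    (b : Fin m) :
    Matrix.vecMul (Sum.elim 0 (stateVec N p u v)) ((d.pencil N p).map φ)
        (Sum.inl (⟨j + 1, hj⟩, b)) =
      φ (d.g (j + 1)) * u j b - φ (d.h (j + 1)) * u (j + 1) b -
        if j + 1 = p then φ (d.h p) * ∑ c, φ (C (d.U b c)) * v 0 c else 0 := by
  have hsplit : ∀ i : ℕ, (if j + 1 = i then u i b * φ (-d.h i) else
      if j + 1 = i + 1 then u i b * φ (d.g (i + 1)) else 0) =
      (if j + 1 = i then -φ (d.h i) * u i b else 0) +
        if j = i then φ (d.g (i + 1)) * u i b else 0 := fun i => by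
    by_cases h : j + 1 = i
    · subst h; simp [mul_comm]
    · simp [h, mul_comm]
  have hj' : j < p := by omega
  have hlast : (if j + 1 < p then -φ (d.h (j + 1)) * u (j + 1) b else 0) =
      -φ (d.h (j + 1)) * u (j + 1) b := by
    split_ifs with h
    · rfl
    · rw [show j + 1 = p by omega, hu, Pi.zero_apply, mul_zero]
  have h0 : 0 < N - 1 - p := by omega
  simp only [Matrix.vecMul, dotProduct, Fintype.sum_sum_type, Fintype.sum_prod_type, pencil,
    LowRankData.K, stateVec, Matrix.map_apply, Matrix.fromRows_apply_inr,
    Matrix.fromBlocks_apply₁₁, Matrix.fromBlocks_apply₂₁, Matrix.of_apply, Sum.elim_inl,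
    Sum.elim_inr, Pi.zero_apply, zero_mul, Finset.sum_const_zero, zero_add, ite_and,
    apply_ite φ, map_zero, mul_ite, mul_zero, Finset.sum_ite_eq', Finset.mem_univ, if_true]
  rw [Fin.sum_univ_eq_sum_range (fun i => if j + 1 = i then u i b * φ (-d.h i) else
      if j + 1 = i + 1 then u i b * φ (d.g (i + 1)) else 0),
    Fin.sum_univ_eq_sum_range (fun i => ∑ c, if i = 0 then
      if j + 1 = p then v i c * φ (-d.h p * C (d.U b c)) else 0 else 0), Finset.sum_comm]
  simp only [hsplit, Finset.sum_add_distrib, Finset.sum_ite_eq, Finset.sum_ite_eq',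
    Finset.mem_range, hj', h0, if_true, hlast]
  split_ifs
  · simp only [map_mul, map_neg, Finset.mul_sum]
    rw [sub_eq_add_neg _ (Finset.sum _ _), ← Finset.sum_neg_distrib]
    refine congrArg₂ _ (by ring) (Finset.sum_congr rfl fun c _ => by ring)
  · rw [Finset.sum_const_zero]
    ring

theorem vecMul_pencil_inr (hv : v (N - 1 - p) = 0) (j : Fin (N - 1 - p)) (c : Fin r) :
    Matrix.vecMul (Sum.elim 0 (stateVec N p u v)) ((d.pencil N p).map φ) (Sum.inr (j, c)) =
      φ (d.g (p + 1 + j)) * v j c - φ (d.h (p + 1 + j)) * v (j + 1) c := by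
  have hsplit : ∀ i : ℕ, (if (j : ℕ) + 1 = i then v i c * φ (-d.h (p + i)) else
      if (j : ℕ) = i then v i c * φ (d.g (p + i + 1)) else 0) =
      (if (j : ℕ) + 1 = i then -φ (d.h (p + i)) * v i c else 0) +
        if (j : ℕ) = i then φ (d.g (p + i + 1)) * v i c else 0 := fun i => by
    by_cases h : (j : ℕ) + 1 = i
    · subst h; simp [mul_comm]
    · simp [h, mul_comm]
  have hlast : (if (j : ℕ) + 1 < N - 1 - p then -φ (d.h (p + (j + 1))) * v (j + 1) c else 0) =
      -φ (d.h (p + (j + 1))) * v (j + 1) c := by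
    split_ifs with h
    · rfl
    · rw [show (j : ℕ) + 1 = N - 1 - p by omega, hv, Pi.zero_apply, mul_zero]
  simp only [Matrix.vecMul, dotProduct, Fintype.sum_sum_type, Fintype.sum_prod_type, pencil,
    LowRankData.K, stateVec, Matrix.map_apply, Matrix.fromRows_apply_inr,
    Matrix.fromBlocks_apply₁₂, Matrix.fromBlocks_apply₂₂, Matrix.of_apply, Sum.elim_inl,
    Sum.elim_inr, Pi.zero_apply, zero_mul, Finset.sum_const_zero, zero_add, Matrix.zero_apply,
    apply_ite φ, map_zero, mul_ite, mul_zero, Finset.sum_ite_eq', Finset.mem_univ, if_true]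
  rw [Fin.sum_univ_eq_sum_range (fun i => if (j : ℕ) + 1 = i then v i c * φ (-d.h (p + i)) else
      if (j : ℕ) = i then v i c * φ (d.g (p + i + 1)) else 0)]
  simp only [hsplit, Finset.sum_add_distrib, Finset.sum_ite_eq, Finset.mem_range, hlast, j.2,
    if_true]
  rw [show p + (j + 1 : ℕ) = p + 1 + j by omega, show p + (j : ℕ) + 1 = p + 1 + j by omega]
  ring

end Action

/-! ### Scalar factors -/

theorem eval_g_eq_zero {i : ℕ} {z : F} (hβ : d.β i ≠ 0) (h : (d.g i).eval z = 0) :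
    d.ξ i = (z : OnePoint F) := by
  have h1 : 1 - poleInv (d.ξ i) * z = 0 := by
    simpa [g, hβ] using h
  cases hξ : d.ξ i with
  | infty => simp [hξ, poleInv] at h1
  | coe y =>
    rw [hξ, poleInv, OnePoint.elim_some] at h1
    have hy : y ≠ 0 := by
      rintro rfl
      simp at h1
    rw [sub_eq_zero, eq_comm, inv_mul_eq_one₀ hy] at h1
    rw [h1]

theorem eval_zero_g (i : ℕ) : (d.g i).eval 0 = d.β i := by simp [g]

theorem natDegree_g_le (i : ℕ) : (d.g i).natDegree ≤ 1 := by
  refine (natDegree_C_mul_le _ _).trans ((natDegree_sub_le _ _).trans ?_)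
  simpa using (natDegree_C_mul_le _ _).trans natDegree_X_le

theorem natDegree_h_le (j : ℕ) : (d.h j).natDegree ≤ 1 := natDegree_X_sub_C_le _

theorem natDegree_pencil_le (N p : ℕ) (i : Fin m ⊕ StateIdx N p m r) (j : ColIdx N p m r) :
    (d.pencil N p i j).natDegree ≤ 1 := by
  have hneg : ∀ i, (-d.h i).natDegree ≤ 1 := fun i => by
    rw [natDegree_neg]; exact d.natDegree_h_le i
  have hM : ∀ (q : F[X]) (a b : F), q.natDegree ≤ 1 → (C a * q * C b).natDegree ≤ 1 :=
    fun q a b hq => (natDegree_mul_C_le _ _).trans ((natDegree_C_mul_le _ _).trans hq)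
  rcases i with a | (ia | ia) <;> rcases j with jb | jb
  · exact hM _ _ _ (d.natDegree_g_le N)
  · simp only [pencil, M, Matrix.fromRows_apply_inl, Matrix.fromCols_apply_inr, Matrix.of_apply]
    refine natDegree_add_le_of_degree_le (hM _ _ _ (d.natDegree_g_le N)) ?_
    split_ifs
    · exact hM _ _ _ (d.natDegree_h_le _)
    · simp
  · simp only [pencil, K, Matrix.fromRows_apply_inr, Matrix.fromBlocks_apply₁₁, Matrix.of_apply]
    split_ifs <;> simp [natDegree_h_le, natDegree_g_le]
  · simp [pencil, K]
  · simp only [pencil, K, Matrix.fromRows_apply_inr, Matrix.fromBlocks_apply₂₁, Matrix.of_apply]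
    split_ifs
    · exact (natDegree_mul_C_le _ _).trans (hneg _)
    · simp
  · simp only [pencil, K, Matrix.fromRows_apply_inr, Matrix.fromBlocks_apply₂₂, Matrix.of_apply]
    split_ifs <;> simp [natDegree_h_le, natDegree_g_le]

/-! ### Right kernels at a point -/

section RightKernel

variable {N p : ℕ} {z : F} {x : ℕ → Fin m → F} {y : ℕ → Fin r → F}

/-- The equations expressing that the block rows of `K̃_N(z)` annihilate a block vector. -/
structure IsStateKernel (N p : ℕ) (z : F) (x : ℕ → Fin m → F) (y : ℕ → Fin r → F) : Prop where
  left : ∀ i, i < p → (d.h i).eval z • x i = (d.g (i + 1)).eval z • x (i + 1)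
  middle : (d.h p).eval z • d.U.transpose.mulVec (x p) = (d.g (p + 1)).eval z • y 0
  right : ∀ i, i + 1 < N - 1 - p →
    (d.h (p + 1 + i)).eval z • y i = (d.g (p + 1 + (i + 1))).eval z • y (i + 1)

theorem isStateKernel_of_mulVec_eq_zero (hN : p + 2 ≤ N)
    (h : ∀ i, (evalPoly (d.pencil N p) z).mulVec (blockVec N p x y) (Sum.inr i) = 0) :
    d.IsStateKernel N p z x y := by
  rw [evalPoly_eq_map] at h
  refine ⟨fun i hi => funext fun a => ?_, funext fun c => ?_, fun i hi => funext fun c => ?_⟩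
  · have := h (Sum.inl (⟨i, hi⟩, a))
    rw [pencil_mulVec_state_inl, sub_eq_zero] at this
    exact this.symm
  · have := h (Sum.inr (⟨0, by omega⟩, c))
    rw [pencil_mulVec_state_inr_zero, sub_eq_zero] at this
    simpa [Matrix.mulVec, dotProduct] using this.symm
  · have := h (Sum.inr (⟨i + 1, hi⟩, c))
    rw [pencil_mulVec_state_inr_succ, sub_eq_zero] at this
    exact this.symm

theorem blockVec_eq_zero (hx : ∀ j, j ≤ p → x j = 0) (hy : ∀ j, j < N - 1 - p → y j = 0) :
    blockVec N p x y = 0 := by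
  ext (⟨j, b⟩ | ⟨j, c⟩)
  · exact congrFun (hx j (by omega)) b
  · exact congrFun (hy j j.2) c

/-- Where no `g_i` vanishes, a vector annihilated by `K̃_N(z)` is determined by its first block. -/
theorem IsStateKernel.blockVec_eq_zero_of_g_ne_zero {d : LowRankData F m r}
    (hk : d.IsStateKernel N p z x y)
    (hg : ∀ i, 1 ≤ i → i ≤ N - 1 → (d.g i).eval z ≠ 0) (hN : p + 2 ≤ N) (hx0 : x 0 = 0) :
    blockVec N p x y = 0 := by
  have hx : ∀ j, j ≤ p → x j = 0 := by
    intro j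
    induction j with
    | zero => exact fun _ => hx0
    | succ j ih =>
      intro hj
      have := hk.left j hj
      rw [ih (by omega), smul_zero, eq_comm] at this
      exact (smul_eq_zero.1 this).resolve_left (hg _ (by omega) (by omega))
  refine blockVec_eq_zero hx fun j => ?_
  induction j with
  | zero =>
    intro _
    have := hk.middle
    rw [hx p le_rfl, Matrix.mulVec_zero, smul_zero, eq_comm] at this
    exact (smul_eq_zero.1 this).resolve_left (hg _ (by omega) (by omega))
  | succ j ih =>
    intro hj
    have := hk.right j hj
    rw [ih (by omega), smul_zero, eq_comm] at this
    exact (smul_eq_zero.1 this).resolve_left (hg _ (by omega) (by omega))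

/-- The matrix `R̃_N(z)`, written with the values of `g_i` and `h_j`. -/
theorem evalRat_R (hh : ∀ j, j ≤ N - 1 → (d.h j).eval z ≠ 0) (hp : 1 ≤ p) (hN : p + 2 ≤ N) :
    evalRat (d.R N p) z = Matrix.fromRows
      (Matrix.fromCols
        (((d.g N).eval z / (d.h (N - 1)).eval z) •
          (∑ j ∈ Finset.Icc 1 (p - 1),
            (∏ k ∈ Finset.Icc (j + 1) p, (d.g k).eval z / (d.h (k - 1)).eval z) • d.D j + d.D p))
        (∑ j ∈ Finset.Icc (p + 1) (N - 1),
          (∏ k ∈ Finset.Icc (j + 1) N, (d.g k).eval z / (d.h (k - 1)).eval z) • d.L j + d.L N))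
      (Matrix.fromBlocks
        (((∏ i ∈ Finset.Icc 1 (p - 1), (d.g i).eval z / (d.h i).eval z) * (d.g p).eval z) • 1)
        0
        (-(d.h p).eval z • d.U.transpose)
        (((∏ i ∈ Finset.Icc (p + 1) (N - 2), (d.g i).eval z / (d.h i).eval z) *
          (d.g (N - 1)).eval z) • 1)) := by
  have hgv : ∀ i, HasValueAt z (d.gRat i) ((d.g i).eval z) := fun i => HasValueAt.algebraMap _
  have hhv : ∀ i, HasValueAt z (d.hRat i) ((d.h i).eval z) := fun i => HasValueAt.algebraMap _
  have hdiv : ∀ i j, j ≤ N - 1 →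
      HasValueAt z (d.gRat i / d.hRat j) ((d.g i).eval z / (d.h j).eval z) :=
    fun i j hj => (hgv i).div (hhv j) (hh j hj)
  ext (a | (a | c)) (b | b)
  all_goals refine HasValueAt.eval_eq ?_
  · simp only [R, Matrix.fromRows_apply_inl, Matrix.fromCols_apply_inl, R1, Matrix.smul_apply,
      Matrix.add_apply, Matrix.sum_apply, Matrix.map_apply, smul_eq_mul]
    exact (hdiv _ _ le_rfl).mul ((HasValueAt.sum _ fun j hj => (HasValueAt.prod _ fun k hk =>
      hdiv _ _ (by rw [Finset.mem_Icc] at hk; omega)).mul (.const _)).add (.const _))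
  · simp only [R, Matrix.fromRows_apply_inl, Matrix.fromCols_apply_inr, R2, Matrix.smul_apply,
      Matrix.add_apply, Matrix.sum_apply, Matrix.map_apply, smul_eq_mul]
    exact (HasValueAt.sum _ fun j hj => (HasValueAt.prod _ fun k hk =>
      hdiv _ _ (by rw [Finset.mem_Icc] at hk; omega)).mul (.const _)).add (.const _)
  · exact hasValueAt_smul_one ((HasValueAt.prod _ fun k hk =>
      hdiv _ _ (by rw [Finset.mem_Icc] at hk; omega)).mul (hgv _)) a b
  · exact HasValueAt.zero
  · exact (hhv p).neg.mul (.const _)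
  · exact hasValueAt_smul_one ((HasValueAt.prod _ fun k hk =>
      hdiv _ _ (by rw [Finset.mem_Icc] at hk; omega)).mul (hgv _)) c b

/-- Where no `h_j` vanishes, a vector in the kernel of the pencil with first block zero is determined
by its blocks in the columns `p` and `N - 1`, and these two blocks form a vector in the kernel of
`R̃_N(z)`. -/
theorem IsStateKernel.blockVec_eq_zero_of_rank_R {d : LowRankData F m r}
    (hk : d.IsStateKernel N p z x y) (hβ : d.β N ≠ 0)
    (hh : ∀ j, j ≤ N - 1 → (d.h j).eval z ≠ 0) (hp : 1 ≤ p) (hN : p + 2 ≤ N) (hx0 : x 0 = 0)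
    (hR : (evalRat (d.R N p) z).rank = m + r)
    (hout : ∀ a, (evalPoly (d.pencil N p) z).mulVec (blockVec N p x y) (Sum.inl a) = 0) :
    blockVec N p x y = 0 := by
  obtain ⟨n, rfl⟩ : ∃ n, N = p + 2 + n := ⟨N - (p + 2), by omega⟩
  have hN1 : p + 2 + n - 1 = p + 1 + n := by omega
  have hlen : p + 1 + n - p = n + 1 := by omega
  have hx : ∀ i, i ≤ p → x i =
      (∏ k ∈ Finset.Icc (i + 1) p, (d.g k).eval z / (d.h (k - 1)).eval z) • x p := fun i hi =>
    eq_prod_smul_of_recurrence (fun k => (d.g k).eval z) (fun k => (d.h k).eval z) x 0 p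
      (fun i _ hi => hh i (by omega)) (fun i _ hi => hk.left i hi) i (Nat.zero_le _) hi
  have hy : ∀ i, i ≤ n → y i =
      (∏ k ∈ Finset.Icc (p + 1 + i + 1) (p + 1 + n), (d.g k).eval z / (d.h (k - 1)).eval z) •
        y n := fun i hi => by
    have := eq_prod_smul_of_recurrence (fun k => (d.g k).eval z) (fun k => (d.h k).eval z)
      (fun k => y (k - (p + 1))) (p + 1) (p + 1 + n)
      (fun i _ hi => hh i (by omega)) (fun i hi hi' => by
        obtain ⟨i, rfl⟩ := Nat.exists_eq_add_of_le hi
        have := hk.right i (by omega)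
        rwa [Nat.add_sub_cancel_left, Nat.add_assoc (p + 1) i 1, Nat.add_sub_cancel_left])
      (p + 1 + i) (by omega) (by omega)
    simpa using this
  have hrow1 : (d.g (p + 2 + n)).eval z • (∑ j ∈ Finset.range (p + 1), (d.D j).mulVec (x j) +
      ∑ j ∈ Finset.range (n + 1), (d.L (p + 1 + j)).mulVec (y j)) +
      (d.h (p + 1 + n)).eval z • (d.L (p + 2 + n)).mulVec (y n) = 0 := by
    funext a
    have := hout a
    rw [evalPoly_eq_map, pencil_mulVec_output _ _ _ _ _ _ hN, hN1, hlen,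
      show p + 2 + n - 2 - p = n by omega] at this
    simp only [coe_evalRingHom, eval_C, mul_eq_zero, inv_eq_zero, hβ, false_or] at this
    simpa [Matrix.mulVec, dotProduct, Finset.sum_apply, mul_add] using this
  have hsumD : ∑ j ∈ Finset.Icc 1 (p - 1),
      (∏ k ∈ Finset.Icc (j + 1) p, (d.g k).eval z / (d.h (k - 1)).eval z) •
        (d.D j).mulVec (x p) + (d.D p).mulVec (x p) =
      ∑ j ∈ Finset.range (p + 1), (d.D j).mulVec (x j) := by
    rw [Finset.sum_range_succ]
    obtain ⟨q, rfl⟩ : ∃ q, p = q + 1 := ⟨p - 1, by omega⟩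
    rw [Finset.sum_range_succ', hx0, Matrix.mulVec_zero, add_zero, sum_Icc_eq_sum_range]
    refine congrArg (· + _) (Finset.sum_congr (by simp) fun j hj => ?_)
    rw [add_comm 1 j, hx (j + 1) (by rw [Finset.mem_range] at hj; omega), Matrix.mulVec_smul]
  have hsumL : ∑ j ∈ Finset.Icc (p + 1) (p + 1 + n),
      (∏ k ∈ Finset.Icc (j + 1) (p + 2 + n), (d.g k).eval z / (d.h (k - 1)).eval z) •
        (d.L j).mulVec (y n) =
      ((d.g (p + 2 + n)).eval z / (d.h (p + 1 + n)).eval z) •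
        ∑ j ∈ Finset.range (n + 1), (d.L (p + 1 + j)).mulVec (y j) := by
    rw [sum_Icc_eq_sum_range, Finset.smul_sum]
    refine Finset.sum_congr (by congr 1; omega) fun j hj => ?_
    rw [Finset.mem_range] at hj
    rw [hy j (by omega), Matrix.mulVec_smul, smul_smul, show p + 2 + n = p + 1 + n + 1 by omega,
      Finset.prod_Icc_succ_top (by omega), Nat.add_sub_cancel, mul_comm]
  have hker : (evalRat (d.R (p + 2 + n) p) z).mulVec (Sum.elim (x p) (y n)) = 0 := by
    rw [d.evalRat_R hh hp hN, Matrix.fromRows_mulVec, Matrix.fromCols_mulVec,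
      Matrix.fromBlocks_mulVec]
    simp only [Sum.elim_comp_inl, Sum.elim_comp_inr, Matrix.add_mulVec, Matrix.sum_mulVec,
      Matrix.smul_mulVec, Matrix.one_mulVec, Matrix.zero_mulVec, add_zero]
    rw [hN1, hsumD, hsumL, show p + 2 + n - 2 = p + 1 + n - 1 by omega,
      prod_Icc_div_mul (fun i => (d.g i).eval z) (fun i => (d.h i).eval z) 0 p hp,
      prod_Icc_div_mul (fun i => (d.g i).eval z) (fun i => (d.h i).eval z) p (p + 1 + n)
        (by omega), mul_smul, mul_smul, ← hx (0 + 1) hp, ← hy 0 (Nat.zero_le _), ← hk.left 0 hp,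
      ← hk.middle, hx0, smul_zero, neg_smul, neg_add_cancel, ← add_assoc, ← smul_add,
      div_eq_inv_mul, mul_smul]
    have := congrArg (((d.h (p + 1 + n)).eval z)⁻¹ • ·) hrow1
    simp only [smul_add, smul_zero, inv_smul_smul₀ (hh (p + 1 + n) (by omega))] at this
    rw [smul_add, smul_add, this]
    ext (a | (a | a)) <;> rfl
  have hzero := mulVec_eq_zero_of_rank_eq_card (by simpa using hR) hker
  have hxp : x p = 0 := funext fun a => congrFun hzero (Sum.inl a)
  have hyn : y n = 0 := funext fun a => congrFun hzero (Sum.inr a)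
  refine blockVec_eq_zero (fun j hj => ?_) fun j hj => ?_
  · rw [hx j hj, hxp, smul_zero]
  · rw [hy j (by omega), hyn, smul_zero]

end RightKernel

/-! ### Left kernels at a point -/

/-- The rows of `K̃_N(z)` are linearly independent at every `z`. By separation of poles and nodes,
either no `h_j` vanishes at `z` and the blocks of a left kernel vector vanish successively from the
first one, or no `g_i` vanishes and they vanish successively from the last one. -/
theorem stateVec_eq_zero_of_vecMul_eq_zero {N p : ℕ} {z : F} (hp : 1 ≤ p) (hN : p + 2 ≤ N)
    (hU : d.U.rank = r)
    (hgh : (∀ i, 1 ≤ i → i ≤ N - 1 → (d.g i).eval z ≠ 0) ∨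
      ∀ j, j ≤ N - 1 → (d.h j).eval z ≠ 0)
    (w : StateIdx N p m r → F)
    (hw : Matrix.vecMul (Sum.elim 0 w) (evalPoly (d.pencil N p) z) = 0) : w = 0 := by
  obtain ⟨u, v, rfl, hu, hv⟩ := exists_eq_stateVec w
  rw [evalPoly_eq_map] at hw
  have hUinj : d.U.mulVec (v 0) = 0 → v 0 = 0 :=
    mulVec_eq_zero_of_rank_eq_card (by simpa using hU)
  have hcol : ∀ j, j < p → (d.g (j + 1)).eval z • u j - (d.h (j + 1)).eval z • u (j + 1) -
      (if j + 1 = p then (d.h p).eval z • d.U.mulVec (v 0) else 0) = 0 := fun j hj => by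
    funext b
    have := congrFun hw (Sum.inl (⟨j + 1, by omega⟩, b))
    rw [vecMul_pencil_succ _ _ _ _ _ _ hN (hu p le_rfl)] at this
    by_cases h : j + 1 = p <;> simpa [h, Matrix.mulVec, dotProduct] using this
  have hcol' : ∀ j, j < N - 1 - p →
      (d.g (p + 1 + j)).eval z • v j = (d.h (p + 1 + j)).eval z • v (j + 1) := fun j hj => by
    funext c
    have := congrFun hw (Sum.inr (⟨j, hj⟩, c))
    rw [vecMul_pencil_inr _ _ _ _ _ _ (hv _ le_rfl)] at this
    exact sub_eq_zero.1 this
  suffices h : (∀ j, u j = 0) ∧ ∀ j, v j = 0 by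
    ext (⟨j, b⟩ | ⟨j, c⟩)
    · exact congrFun (h.1 j) b
    · exact congrFun (h.2 j) c
  rcases hgh with hg | hh
  · have hv0 : ∀ j, v j = 0 := fun j => by
      rcases le_total (N - 1 - p) j with hj | hj
      · exact hv j hj
      · induction hj using Nat.decreasingInduction with
        | self => exact hv _ le_rfl
        | of_succ j hj ih =>
          have := hcol' j hj
          rw [ih, smul_zero] at this
          exact (smul_eq_zero.1 this).resolve_left (hg _ (by omega) (by omega))
    refine ⟨fun j => ?_, hv0⟩
    rcases le_total p j with hj | hj
    · exact hu j hj
    · induction hj using Nat.decreasingInduction with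
      | self => exact hu _ le_rfl
      | of_succ j hj ih =>
        have := hcol j hj
        rw [hv0 0, Matrix.mulVec_zero, smul_zero, ite_self, sub_zero, ih, smul_zero,
          sub_zero] at this
        exact (smul_eq_zero.1 this).resolve_left (hg _ (by omega) (by omega))
  · have hu0 : ∀ j, u j = 0 := fun j => by
      induction j with
      | zero =>
        funext b
        have := congrFun hw (Sum.inl (0, b))
        rw [vecMul_pencil_zero _ _ _ _ _ _ hp] at this
        exact (mul_eq_zero.1 (neg_eq_zero.1 this)).resolve_left (hh 0 (Nat.zero_le _))
      | succ j ih =>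
        rcases le_or_gt p (j + 1) with hj | hj
        · exact hu _ hj
        · have := hcol j (by omega)
          rw [ih, smul_zero, zero_sub, if_neg (by omega), sub_zero, neg_eq_zero] at this
          exact (smul_eq_zero.1 this).resolve_left (hh _ (by omega))
    refine ⟨hu0, fun j => ?_⟩
    induction j with
    | zero =>
      have := hcol (p - 1) (by omega)
      rw [hu0, hu0, smul_zero, smul_zero, sub_zero, zero_sub, if_pos (by omega),
        neg_eq_zero] at this
      exact hUinj ((smul_eq_zero.1 this).resolve_left (hh _ (by omega)))
    | succ j ih =>
      rcases le_or_gt (N - 1 - p) (j + 1) with hj | hj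
      · exact hv _ hj
      · have := hcol' j (by omega)
        rw [ih, smul_zero, eq_comm] at this
        exact (smul_eq_zero.1 this).resolve_left (hh _ (by omega))

/-! ### The transfer function -/

theorem g_ne_zero {i : ℕ} (hβ : d.β i ≠ 0) : d.g i ≠ 0 := fun h =>
  hβ (by rw [← d.eval_zero_g, h, eval_zero])

theorem gRat_mul_b_succ {i : ℕ} (hβ : d.β (i + 1) ≠ 0) :
    d.gRat (i + 1) * d.b (i + 1) = d.hRat i * d.b i := by
  have hg : d.gRat (i + 1) ≠ 0 := fun h =>
    d.g_ne_zero hβ ((map_eq_zero_iff _ (RatFunc.algebraMap_injective F)).1 h)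
  rw [b, b, Finset.prod_Icc_succ_top (by omega), Nat.add_sub_cancel]
  field_simp

/-- The matrix with block rows `b_0 β_0 I, …, b_p β_0 I, b_{p+1} β_0 Ũᵀ, …, b_{N-1} β_0 Ũᵀ`, whose
columns span the right kernel of `K̃_N`. -/
noncomputable def kernelMatrix (N p : ℕ) : Matrix (ColIdx N p m r) (Fin m) (RatFunc F) :=
  Matrix.of fun k e => blockVec N p
    (fun j b => RatFunc.C (d.β 0) * d.b j * (1 : Matrix (Fin m) (Fin m) (RatFunc F)) b e)
    (fun i c => RatFunc.C (d.β 0) * d.b (p + 1 + i) * RatFunc.C (d.U e c)) k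

theorem det_stateBlock_pencil_ne_zero {N p : ℕ} (hN : p + 2 ≤ N) (hβ : ∀ i, i ≤ N → d.β i ≠ 0) :
    (stateBlock (d.pencil N p) (rowPartition N p m r) (colPartition N p m r)).det ≠ 0 := by
  -- At `0` every `g_i` takes the nonzero value `β_i`.
  refine det_stateBlock_ne_zero _ _ _ 0 fun w hw0 hw => ?_
  obtain ⟨x, y, rfl⟩ := exists_eq_blockVec w
  refine (d.isStateKernel_of_mulVec_eq_zero hN hw).blockVec_eq_zero_of_g_ne_zero
    (fun i _ hi => ?_) hN (funext hw0)
  rw [eval_zero_g]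
  exact hβ i (by omega)

/-- The transfer function of the pencil is `(β_0 g_N / β_N) Q̃_N`. -/
theorem transferFunction_pencil {N p : ℕ} (hN : p + 2 ≤ N) (hβ : ∀ i, i ≤ N → d.β i ≠ 0) :
    transferFunction (d.pencil N p) (rowPartition N p m r) (colPartition N p m r) =
      algebraMap F[X] (RatFunc F) (C (d.β 0) * C (d.β N)⁻¹ * d.g N) • d.Q N p := by
  have hβ0 : RatFunc.C (d.β 0) ≠ 0 := by
    simpa using hβ 0 (Nat.zero_le _)
  have hrec : ∀ i, i + 1 ≤ N → d.gRat (i + 1) * d.b (i + 1) = d.hRat i * d.b i :=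
    fun i hi => d.gRat_mul_b_succ (hβ _ hi)
  have hcol : ∀ i e, (toRat (d.pencil N p) * d.kernelMatrix N p) i e =
      ((d.pencil N p).map (algebraMap F[X] (RatFunc F))).mulVec (blockVec N p
        (fun j b => RatFunc.C (d.β 0) * d.b j * (1 : Matrix (Fin m) (Fin m) (RatFunc F)) b e)
        (fun i c => RatFunc.C (d.β 0) * d.b (p + 1 + i) * RatFunc.C (d.U e c))) i :=
    fun _ _ => rfl
  have hdelta : ∀ (f : Fin m → RatFunc F) (t : RatFunc F) (e : Fin m),
      ∑ b, f b * (t * (1 : Matrix (Fin m) (Fin m) (RatFunc F)) b e) = f e * t := fun f t e => by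
    simp [Matrix.one_apply]
  rw [transferFunction_eq_mul _ _ _ (d.det_stateBlock_pencil_ne_zero hN hβ)
    (d.kernelMatrix N p)]
  · ext a e
    have hN' : N - 1 + 1 = N := by omega
    have hsum : ∀ f : ℕ → RatFunc F, ∑ i ∈ Finset.Icc (p + 1) N, f i =
        ∑ j ∈ Finset.range (N - 1 - p), f (p + 1 + j) + f N := fun f => by
      rw [sum_Icc_eq_sum_range, show N + 1 - (p + 1) = N - 1 - p + 1 by omega,
        Finset.sum_range_succ, show p + 1 + (N - 1 - p) = N by omega]
    have hlast := hrec (N - 1) (by omega)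
    rw [hN'] at hlast
    change (toRat (d.pencil N p) * d.kernelMatrix N p) (Sum.inl a) e = _
    rw [hcol, pencil_mulVec_output _ _ _ _ _ _ hN, Matrix.smul_apply, Q, Matrix.add_apply,
      Matrix.sum_apply, Matrix.sum_apply, hsum, sum_Icc_eq_sum_range,
      show p + 1 + (N - 2 - p) = N - 1 by omega]
    simp only [hdelta, Matrix.smul_apply, smul_eq_mul, Matrix.map_apply, Matrix.mul_apply,
      Matrix.transpose_apply, map_sum, map_mul, RatFunc.algebraMap_C, Nat.sub_zero, zero_add]
    change RatFunc.C (d.β N)⁻¹ * (d.gRat N * _ + d.hRat (N - 1) * _) =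
      RatFunc.C (d.β 0) * RatFunc.C (d.β N)⁻¹ * d.gRat N * _
    have hD : ∑ j ∈ Finset.range (p + 1), RatFunc.C (d.D j a e) * (RatFunc.C (d.β 0) * d.b j) =
        RatFunc.C (d.β 0) * ∑ j ∈ Finset.range (p + 1), d.b j * RatFunc.C (d.D j a e) := by
      rw [Finset.mul_sum]
      exact Finset.sum_congr rfl fun j _ => by ring
    have hL : ∀ k, ∑ c, RatFunc.C (d.L k a c) *
        (RatFunc.C (d.β 0) * d.b k * RatFunc.C (d.U e c)) =
        RatFunc.C (d.β 0) * (d.b k * ∑ c, RatFunc.C (d.L k a c) * RatFunc.C (d.U e c)) :=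
      fun k => by
        rw [Finset.mul_sum, Finset.mul_sum]
        exact Finset.sum_congr rfl fun j _ => by ring
    -- The last node factor turns `b_{N-1}` into `b_N`.
    have hLN : d.hRat (N - 1) * ∑ c, RatFunc.C (d.L N a c) *
        (RatFunc.C (d.β 0) * d.b (N - 1) * RatFunc.C (d.U e c)) =
        d.gRat N * (RatFunc.C (d.β 0) *
          (d.b N * ∑ c, RatFunc.C (d.L N a c) * RatFunc.C (d.U e c))) := by
      rw [← hL, Finset.mul_sum, Finset.mul_sum]
      refine Finset.sum_congr rfl fun c _ => ?_
      linear_combination (-RatFunc.C (d.L N a c) * RatFunc.C (d.β 0) * RatFunc.C (d.U e c)) * hlast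
    rw [hD, hLN]
    simp only [hL, ← Finset.mul_sum]
    ring
  · intro i e
    change (toRat (d.pencil N p) * d.kernelMatrix N p) (Sum.inr i) e = 0
    rw [hcol]
    rcases i with ⟨i, a⟩ | ⟨⟨i, hi⟩, c⟩
    · rw [pencil_mulVec_state_inl]
      have := hrec i (by omega)
      change d.gRat (i + 1) * _ - d.hRat i * _ = 0
      linear_combination (RatFunc.C (d.β 0) * (1 : Matrix _ _ (RatFunc F)) a e) * this
    · cases i with
      | zero =>
        rw [pencil_mulVec_state_inr_zero, hdelta, RatFunc.algebraMap_C]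
        have := hrec p (by omega)
        change d.gRat (p + 1) * (_ * d.b (p + 1) * _) - d.hRat p * _ = 0
        linear_combination (RatFunc.C (d.β 0) * RatFunc.C (d.U e c)) * this
      | succ i =>
        rw [pencil_mulVec_state_inr_succ]
        have := hrec (p + 1 + i) (by omega)
        change d.gRat (p + 1 + i + 1) * (_ * d.b (p + 1 + i + 1) * _) - d.hRat (p + 1 + i) * _ = 0
        linear_combination (RatFunc.C (d.β 0) * RatFunc.C (d.U e c)) * this
  · intro b e
    change RatFunc.C (d.β 0) * d.b 0 * _ = _
    rw [LowRankData.b, Finset.Icc_eq_empty (by omega), Finset.prod_empty, mul_one,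
      mul_inv_cancel₀ hβ0, one_mul]

/-! ### Linearization -/

/-- The pencil is minimal at every point. -/
theorem minimalAt_pencil {N p : ℕ} (hp : 1 ≤ p) (hN : p + 2 ≤ N) (hβ : ∀ i, i ≤ N → d.β i ≠ 0)
    (hU : d.U.rank = r)
    (hξσ : ∀ i j, 1 ≤ i → i ≤ N → j ≤ N - 1 → d.ξ i ≠ (d.σ j : OnePoint F))
    (hR : ∀ k, 1 ≤ k → k ≤ N - 1 → ∀ x : F, d.ξ k = (x : OnePoint F) →
      (evalRat (d.R N p) x).rank = m + r) (z : F) :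
    MinimalAt (d.pencil N p) (rowPartition N p m r) (colPartition N p m r) z := by
  have hcases : (∀ i, 1 ≤ i → i ≤ N - 1 → (d.g i).eval z ≠ 0) ∨
      ((∀ j, j ≤ N - 1 → (d.h j).eval z ≠ 0) ∧ (evalRat (d.R N p) z).rank = m + r) := by
    by_contra! hcon
    obtain ⟨⟨i, hi1, hiN, hgi⟩, hcon⟩ := hcon
    have hξ := d.eval_g_eq_zero (hβ i (by omega)) hgi
    refine hcon (fun j hj hhj => hξσ i j hi1 (by omega) hj ?_) (hR i hi1 hiN z hξ)
    rw [hξ, show z = d.σ j by simpa [h, sub_eq_zero] using hhj]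
  refine minimalAt_of_kernels _ _ _ z (fun w hw0 hw => ?_) fun y hy0 hy => ?_
  · obtain ⟨x, y, rfl⟩ := exists_eq_blockVec w
    have hk := d.isStateKernel_of_mulVec_eq_zero hN fun i => congrFun hw (Sum.inr i)
    rcases hcases with hg | ⟨hh, hRz⟩
    · exact hk.blockVec_eq_zero_of_g_ne_zero hg hN (funext hw0)
    · exact hk.blockVec_eq_zero_of_rank_R (hβ N le_rfl) hh hp hN (funext hw0) hRz
        fun a => congrFun hw (Sum.inl a)
  · have hy' : y = Sum.elim (0 : Fin m → F) (y ∘ Sum.inr) := by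
      ext (a | i)
      · exact hy0 a
      · rfl
    rw [hy'] at hy ⊢
    rw [d.stateVec_eq_zero_of_vecMul_eq_zero hp hN hU (hcases.imp_right And.left) _ hy,
      Sum.elim_zero_zero]

end LowRankData

end NLEIGS

theorem theorem6p7 {F : Type*} [Field F] [IsAlgClosed F] (N p m r : ℕ)
    (hp : 1 ≤ p) (hN : p + 2 ≤ N) (d : NLEIGS.LowRankData F m r)
    (hξ : ∀ i, 1 ≤ i → i ≤ N → d.ξ i ≠ ((0 : F) : OnePoint F))
    (hβ : ∀ i, i ≤ N → d.β i ≠ 0)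
    (hU : d.U.rank = r)
    (hξσ : ∀ i j, 1 ≤ i → i ≤ N → j ≤ N - 1 → d.ξ i ≠ (d.σ j : OnePoint F))
    (hR : ∀ k, 1 ≤ k → k ≤ N - 1 → ∀ x : F, d.ξ k = (x : OnePoint F) →
      (NLEIGS.evalRat (d.R N p) x).rank = m + r) :
    NLEIGS.stateBlock (d.pencil N p) (NLEIGS.LowRankData.rowPartition N p m r)
        (NLEIGS.LowRankData.colPartition N p m r) = d.A N p ∧
    (d.ξ N = OnePoint.infty →
      NLEIGS.IsLinearizationIn (d.pencil N p) (NLEIGS.LowRankData.rowPartition N p m r)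
        (NLEIGS.LowRankData.colPartition N p m r) (d.Q N p) Set.univ) ∧
    (∀ x : F, d.ξ N = (x : OnePoint F) →
      NLEIGS.IsLinearizationIn (d.pencil N p) (NLEIGS.LowRankData.rowPartition N p m r)
        (NLEIGS.LowRankData.colPartition N p m r) (d.Q N p) {x}ᶜ) := by
  have hlin : ∀ z : F, d.ξ N ≠ (z : OnePoint F) →
      NLEIGS.IsLinearizationAt (d.pencil N p) (NLEIGS.LowRankData.rowPartition N p m r)
        (NLEIGS.LowRankData.colPartition N p m r) (d.Q N p) z := fun z hz => by
    have hg : (d.g N).eval z ≠ 0 := fun h => hz (d.eval_g_eq_zero (hβ N le_rfl) h)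
    refine NLEIGS.isLinearizationAt_of_transferFunction_eq_smul _ _ _ _ z
      (d.natDegree_pencil_le N p) (d.det_stateBlock_pencil_ne_zero hN hβ)
      (d.minimalAt_pencil hp hN hβ hU hξσ hR z) _ ?_ (d.transferFunction_pencil hN hβ)
    simpa [hβ N le_rfl, hβ 0 (Nat.zero_le _)] using hg
  -- `{ξ_N}ᶜ` contains `0` because the poles are nonzero.
  refine ⟨rfl, fun hinf => ⟨Set.univ_nonempty, fun z _ => hlin z (by simp [hinf])⟩,
    fun x hx => ⟨⟨0, fun h0 => hξ N (by omega) le_rfl ?_⟩, fun z hz => hlin z fun h => hz ?_⟩⟩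
  · rw [hx, Set.mem_singleton_iff.1 h0]
  · exact OnePoint.coe_injective (h.symm.trans hx)
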